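/- All linear spaces are complex. An \emph{operator sequence space} $X$ is a linear space $E$ with a norm $\Vert\cdot\Vert_{\wideparen n}$ on $E^n$ (columns) for every $n\in\mathbb N$ such that $\Vert\alpha x\Vert_{\wideparen m}\le\Vert\alpha\Vert\,\Vert x\Vert_{\wideparen n}$ for all $x\in E^n$ and all complex $m\times n$ matrices $\alpha$ (with the operator norm $\Vert\alpha\Vert$ between Euclidean spaces), and $\Vert (x,y)^{tr}\Vert_{\wideparen{n+m}}^2\le\Vert x\Vert_{\wideparen n}^2+\Vert y\Vert_{\wideparen m}^2$ for all $x\in E^n$, $y\in E^m$. Write $X^{\wideparen n}=(E^n,\Vert\cdot\Vert_{\wideparen n})$. A linear operator $\varphi:X\to Y$ is \emph{sequentially bounded} if $\Vert\varphi\Vert_{sb}:=\sup_n\Vert\varphi^{\wideparen n}\Vert<\infty$, where $\varphi^{\wideparen n}:X^{\wideparen n}\to Y^{\wideparen n}$ acts coordinatewise. Let $SQNor$ be the category of operator sequence spaces and sequentially bounded operators; two spaces are \emph{sequentially topologically isomorphic} if they are isomorphic in $SQNor$. The \emph{sequential dual} $X^\triangle$ is the space $\mathcal{SB}(X,\mathbb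 C)$ of sequentially bounded functionals with $(X^\triangle)^{\wideparen n}=\mathcal{SB}(X,\ell_2^n)$ (normed by $\Vert\cdot\Vert_{sb}$), where a Hilbert space $H$ has the structure $\Vert x\Vert_{\wideparen n}=(\sum_i\Vert x_i\Vert^2)^{1/2}$; for a morphism $\varphi:X\to Y$ put $\varphi^\triangle:Y^\triangle\to X^\triangle$, $f\mapsto f\circ\varphi$. For a normed space $E$, $\min(E)$ is $E$ with the norms $\Vert x\Vert_{\wideparen n}=\sup\{\Vert\sum_i\xi_ix_i\Vert:\xi\in\mathbb C^n,\ \sum_i|\xi_i|^2\le1\}$. A \emph{semilinear normed space} (over $\mathbb C$) is a set $V$ with a multiplication $\mathbb C\times V\to V$ satisfying $\alpha(\beta x)=(\alpha\beta)x$ and $1x=x$, a vector $0\in V$ with $0_{\mathbb C}\,x=0$ for all $x$, and a map $\Vert\cdot\Vert:V\to[0,\infty)$ such that $\Vert x\Vert=0$ implies $x=0$ and $\Vert\alpha x\Vert=|\alpha|\Vert x\Vert$. Let $Nor_0$ be the category of semilinear normed spaces, with morphisms the maps $\varphi$ such that $\varphi(\alpha x)=\alpha\varphi(x)$ and $\Vert\varphi(x)\Vert\le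 C\Vert x\Vert$ for some constant $C$. Let $\square:SQNor\to Nor_0^{o}$ (the opposite category) be the faithful functor that sends $X$ to the underlying semilinear normed space of $(X^\triangle)^{\wideparen 1}$ and $\varphi$ to $\varphi^\triangle$. An operator sequence space $F$ is \emph{pseudotopologically cofree} if there are an object $M$ of $Nor_0^{o}$ and a morphism $j:\square(F)\to M$ in $Nor_0^{o}$ such that for every operator sequence space $X$ and every morphism $\varphi:\square(X)\to M$ in $Nor_0^{o}$ there is a unique sequentially bounded operator $\psi:X\to F$ with $j\circ\square(\psi)=\varphi$. \textbf{Theorem.} An operator sequence space is pseudotopologically cofree if and only if it is sequentially topologically isomorphic to $\min(\ell_\infty(\Lambda))$ for some set $\Lambda$. -/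

import Mathlib

open CategoryTheory Opposite
open scoped ENNReal Matrix.Norms.L2Operator

universe u

noncomputable section

namespace SQ

/-! ### Operator sequence spaces -/

/-- The product `α x` of a scalar matrix and a column of vectors. -/
def matAct {E : Type*} [AddCommGroup E] [Module ℂ E] {m n : ℕ}
    (α : Matrix (Fin m) (Fin n) ℂ) (x : Fin n → E) : Fin m → E :=
  fun i => ∑ j, α i j • x j

/-- The structure of an operator sequence space on a complex linear space `E`: a norm on each space
of columns `Eⁿ`, subject to the two axioms below, where `‖α‖` is the operator norm of the matrix `α`
between Euclidean spaces. (The case `n = 0` only concerns the zero space `E⁰`, so carries no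
information and no restriction.) -/
structure OpSeqStructure (E : Type u) [AddCommGroup E] [Module ℂ E] where
  /-- the norm on columns of height `n` -/
  norm : ∀ n : ℕ, Seminorm ℂ (Fin n → E)
  eq_zero_of_norm_eq_zero : ∀ (n : ℕ) (x : Fin n → E), norm n x = 0 → x = 0
  norm_matAct_le : ∀ (m n : ℕ) (α : Matrix (Fin m) (Fin n) ℂ) (x : Fin n → E),
    norm m (matAct α x) ≤ ‖α‖ * norm n x
  norm_append_sq_le : ∀ (n m : ℕ) (x : Fin n → E) (y : Fin m → E),
    norm (n + m) (Fin.append x y) ^ 2 ≤ norm n x ^ 2 + norm m y ^ 2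

section Hilbert

variable {H : Type u} [NormedAddCommGroup H] [InnerProductSpace ℂ H]

theorem matAct_sq_le_euclidean {m n : ℕ} (α : Matrix (Fin m) (Fin n) ℂ) (v : Fin n → ℂ) :
    ∑ i, ‖∑ j, α i j * v j‖ ^ 2 ≤ ‖α‖ ^ 2 * ∑ j, ‖v j‖ ^ 2 := by
  have h := Matrix.l2_opNorm_mulVec α (WithLp.toLp 2 v)
  have h2 := pow_le_pow_left₀ (norm_nonneg _) h 2
  rw [mul_pow, EuclideanSpace.norm_sq_eq, EuclideanSpace.norm_sq_eq] at h2
  simpa [Matrix.mulVec, dotProduct] using h2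

theorem matAct_sq_le {m n : ℕ} (α : Matrix (Fin m) (Fin n) ℂ) (x : Fin n → H) :
    ∑ i, ‖matAct α x i‖ ^ 2 ≤ ‖α‖ ^ 2 * ∑ j, ‖x j‖ ^ 2 := by
  classical
  let W : Submodule ℂ H := Submodule.span ℂ (Set.range x)
  have : FiniteDimensional ℂ W := FiniteDimensional.span_of_finite ℂ (Set.finite_range x)
  let b := stdOrthonormalBasis ℂ W
  let y : Fin n → W := fun j => ⟨x j, Submodule.subset_span ⟨j, rfl⟩⟩
  have hnorm : ∀ w : W, ‖(w : H)‖ ^ 2 = ∑ l, ‖b.repr w l‖ ^ 2 := by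
    intro w
    rw [← EuclideanSpace.norm_sq_eq, b.repr.norm_map]
    rfl
  have h1 : ∀ i, ‖matAct α x i‖ ^ 2 = ∑ l, ‖∑ j, α i j * b.repr (y j) l‖ ^ 2 := by
    intro i
    have : matAct α x i = ((∑ j, α i j • y j : W) : H) := by
      simp [matAct, y]
    rw [this, hnorm]
    simp
  have h2 : ∀ j, ‖x j‖ ^ 2 = ∑ l, ‖b.repr (y j) l‖ ^ 2 := fun j => hnorm (y j)
  simp_rw [h1, h2]
  rw [Finset.sum_comm, Finset.sum_comm (s := (Finset.univ : Finset (Fin n))), Finset.mul_sum]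
  exact Finset.sum_le_sum fun l _ => matAct_sq_le_euclidean α fun j => b.repr (y j) l

/-- The standard operator sequence structure of a Hilbert space `H`: the `n`-th amplification is the
Hilbert sum of `n` copies of `H`, i.e. `‖x‖ = (∑ ‖x i‖ ^ 2) ^ (1 / 2)`. -/
def hilbert (H : Type u) [NormedAddCommGroup H] [InnerProductSpace ℂ H] : OpSeqStructure H where
  norm n := (normSeminorm ℂ (PiLp 2 fun _ : Fin n => H)).comp
    (WithLp.linearEquiv 2 ℂ (Fin n → H)).symm.toLinearMap
  eq_zero_of_norm_eq_zero n x hx := by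
    have h : WithLp.toLp 2 x = 0 := by simpa using hx
    simpa using h
  norm_matAct_le m n α x := by
    refine le_of_sq_le_sq ?_ (by positivity)
    rw [mul_pow]
    simpa [PiLp.norm_sq_eq_of_L2] using matAct_sq_le α x
  norm_append_sq_le n m x y := by
    simp [PiLp.norm_sq_eq_of_L2, Fin.sum_univ_add]

theorem hilbert_norm_sq {n : ℕ} (x : Fin n → H) :
    (hilbert H).norm n x ^ 2 = ∑ i, ‖x i‖ ^ 2 := by
  simp [hilbert, PiLp.norm_sq_eq_of_L2]

end Hilbert

/-! ### The minimal structure of a normed space -/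

section Min

variable {E : Type u} [NormedAddCommGroup E] [NormedSpace ℂ E]

/-- The operator `ξ ↦ ∑ ξ i • x i` from the Euclidean space `ℓ₂ⁿ` to `E` given by a column `x`; it
depends linearly on `x`. -/
def columnOperator (n : ℕ) : (Fin n → E) →ₗ[ℂ] (EuclideanSpace ℂ (Fin n) →L[ℂ] E) where
  toFun x := ∑ i, (EuclideanSpace.proj i : EuclideanSpace ℂ (Fin n) →L[ℂ] ℂ).smulRight (x i)
  map_add' x y := by
    ext ξ
    simp [Finset.sum_add_distrib]
  map_smul' c x := by
    ext ξ
    simp [Finset.smul_sum, smul_comm c]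

theorem columnOperator_apply {n : ℕ} (x : Fin n → E) (ξ : EuclideanSpace ℂ (Fin n)) :
    columnOperator n x ξ = ∑ i, ξ i • x i := by
  simp [columnOperator]

/-- The minimal operator sequence structure of a normed space `E`: the norm of a column `x` is the
operator norm of `ξ ↦ ∑ ξ i • x i`, from `ℓ₂ⁿ` to `E`. -/
def minStructure (E : Type u) [NormedAddCommGroup E] [NormedSpace ℂ E] : OpSeqStructure E where
  norm n := (normSeminorm ℂ (EuclideanSpace ℂ (Fin n) →L[ℂ] E)).comp (columnOperator n)
  eq_zero_of_norm_eq_zero n x hx := by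
    have h : columnOperator n x = 0 := by simpa using hx
    funext i
    have h2 : columnOperator n x (EuclideanSpace.single i 1) = 0 := by rw [h]; simp
    simpa [columnOperator_apply, Pi.single_apply] using h2
  norm_matAct_le m n α x := by
    change ‖columnOperator m (matAct α x)‖ ≤ ‖α‖ * ‖columnOperator n x‖
    refine ContinuousLinearMap.opNorm_le_bound _ (by positivity) fun ξ => ?_
    let η : EuclideanSpace ℂ (Fin n) := WithLp.toLp 2 fun j => ∑ i, ξ i * α i j
    have h1 : columnOperator m (matAct α x) ξ = columnOperator n x η := by
      simp only [columnOperator_apply, matAct, η, Finset.smul_sum, Finset.sum_smul, smul_smul]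
      rw [Finset.sum_comm]
    have h2 : ‖η‖ ≤ ‖α‖ * ‖ξ‖ := by
      have h := Matrix.l2_opNorm_mulVec α.conjTranspose (WithLp.toLp 2 fun i => star (ξ i))
      rw [Matrix.l2_opNorm_conjTranspose] at h
      refine le_of_sq_le_sq ?_ (by positivity)
      have h' := pow_le_pow_left₀ (norm_nonneg _) h 2
      rw [mul_pow, EuclideanSpace.norm_sq_eq, EuclideanSpace.norm_sq_eq] at h'
      rw [mul_pow, EuclideanSpace.norm_sq_eq, EuclideanSpace.norm_sq_eq]
      have e : ∀ j, ‖η j‖ = ‖∑ i, star (α i j) * star (ξ i)‖ := by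
        intro j
        rw [← norm_star (η j)]
        simp [η, mul_comm]
      simp_rw [e]
      simpa [Matrix.mulVec, dotProduct] using h'
    rw [h1]
    calc ‖columnOperator n x η‖ ≤ ‖columnOperator n x‖ * ‖η‖ := ContinuousLinearMap.le_opNorm _ _
      _ ≤ ‖columnOperator n x‖ * (‖α‖ * ‖ξ‖) := by gcongr
      _ = ‖α‖ * ‖columnOperator n x‖ * ‖ξ‖ := by ring
  norm_append_sq_le n m x y := by
    change ‖columnOperator (n + m) (Fin.append x y)‖ ^ 2
      ≤ ‖columnOperator n x‖ ^ 2 + ‖columnOperator m y‖ ^ 2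
    set a := ‖columnOperator n x‖ with ha
    set b := ‖columnOperator m y‖ with hb
    have h : ‖columnOperator (n + m) (Fin.append x y)‖ ≤ √(a ^ 2 + b ^ 2) := by
      refine ContinuousLinearMap.opNorm_le_bound _ (by positivity) fun ξ => ?_
      let ξ₁ : EuclideanSpace ℂ (Fin n) := WithLp.toLp 2 fun i => ξ (Fin.castAdd m i)
      let ξ₂ : EuclideanSpace ℂ (Fin m) := WithLp.toLp 2 fun i => ξ (Fin.natAdd n i)
      have h1 : columnOperator (n + m) (Fin.append x y) ξ
          = columnOperator n x ξ₁ + columnOperator m y ξ₂ := by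
        simp [columnOperator_apply, Fin.sum_univ_add, ξ₁, ξ₂]
      have h2 : ‖ξ‖ ^ 2 = ‖ξ₁‖ ^ 2 + ‖ξ₂‖ ^ 2 := by
        simp [EuclideanSpace.norm_sq_eq, Fin.sum_univ_add, ξ₁, ξ₂]
      have h3 : ‖columnOperator (n + m) (Fin.append x y) ξ‖ ≤ a * ‖ξ₁‖ + b * ‖ξ₂‖ := by
        rw [h1]
        exact (norm_add_le _ _).trans
          (add_le_add (ContinuousLinearMap.le_opNorm _ _) (ContinuousLinearMap.le_opNorm _ _))
      refine h3.trans ?_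
      refine le_of_sq_le_sq ?_ (by positivity)
      rw [mul_pow, Real.sq_sqrt (by positivity), h2]
      nlinarith [sq_nonneg (a * ‖ξ₂‖ - b * ‖ξ₁‖)]
    calc ‖columnOperator (n + m) (Fin.append x y)‖ ^ 2 ≤ √(a ^ 2 + b ^ 2) ^ 2 := by gcongr
      _ = a ^ 2 + b ^ 2 := Real.sq_sqrt (by positivity)

end Min

/-! ### Sequentially bounded operators -/

section SB

variable {E : Type*} [AddCommGroup E] [Module ℂ E] {F : Type*} [AddCommGroup F] [Module ℂ F]
  {G : Type*} [AddCommGroup G] [Module ℂ G]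

/-- `φ` is bounded by `C` on every amplification. -/
def SeqBoundedBy (S : OpSeqStructure E) (T : OpSeqStructure F) (φ : E →ₗ[ℂ] F) (C : ℝ) : Prop :=
  ∀ (n : ℕ) (x : Fin n → E), T.norm n (fun i => φ (x i)) ≤ C * S.norm n x

/-- Sequentially bounded operators: the norms of all amplifications are uniformly bounded. -/
def SeqBounded (S : OpSeqStructure E) (T : OpSeqStructure F) (φ : E →ₗ[ℂ] F) : Prop :=
  ∃ C : ℝ, 0 ≤ C ∧ SeqBoundedBy S T φ C

/-- `‖φ‖_sb`, the supremum of the norms of the amplifications of `φ`, as the least common bound. -/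
def sbNorm (S : OpSeqStructure E) (T : OpSeqStructure F) (φ : E →ₗ[ℂ] F) : ℝ :=
  sInf {C : ℝ | 0 ≤ C ∧ SeqBoundedBy S T φ C}

variable {S : OpSeqStructure E} {T : OpSeqStructure F} {U : OpSeqStructure G}

theorem sbNorm_nonneg (φ : E →ₗ[ℂ] F) : 0 ≤ sbNorm S T φ :=
  Real.sInf_nonneg fun _ h => h.1

theorem sbNorm_le {φ : E →ₗ[ℂ] F} {C : ℝ} (hC : 0 ≤ C) (h : SeqBoundedBy S T φ C) :
    sbNorm S T φ ≤ C :=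
  csInf_le ⟨0, fun _ h => h.1⟩ ⟨hC, h⟩

theorem SeqBounded.le_sbNorm {φ : E →ₗ[ℂ] F} (h : SeqBounded S T φ) :
    SeqBoundedBy S T φ (sbNorm S T φ) := by
  intro n x
  rcases (apply_nonneg (S.norm n) x).eq_or_lt with h0 | h0
  · obtain ⟨C, -, hC⟩ := h
    have := hC n x
    rw [← h0] at this ⊢
    simpa using this
  · rw [← div_le_iff₀ h0]
    obtain ⟨C, hC⟩ := h
    exact le_csInf ⟨C, hC⟩ fun D hD => (div_le_iff₀ h0).2 (hD.2 n x)

theorem SeqBoundedBy.add {φ ψ : E →ₗ[ℂ] F} {C D : ℝ} (h : SeqBoundedBy S T φ C)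
    (h' : SeqBoundedBy S T ψ D) : SeqBoundedBy S T (φ + ψ) (C + D) := by
  intro n x
  rw [add_mul]
  exact (map_add_le_add (T.norm n) (fun i => φ (x i)) (fun i => ψ (x i))).trans
    (add_le_add (h n x) (h' n x))

theorem SeqBoundedBy.smul {φ : E →ₗ[ℂ] F} {C : ℝ} (h : SeqBoundedBy S T φ C) (c : ℂ) :
    SeqBoundedBy S T (c • φ) (‖c‖ * C) := by
  intro n x
  have e : T.norm n (fun i => (c • φ) (x i)) = ‖c‖ * T.norm n (fun i => φ (x i)) :=
    map_smul_eq_mul (T.norm n) c fun i => φ (x i)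
  rw [e, mul_assoc]
  exact mul_le_mul_of_nonneg_left (h n x) (norm_nonneg c)

theorem SeqBoundedBy.comp {ψ : F →ₗ[ℂ] G} {φ : E →ₗ[ℂ] F} {C D : ℝ} (hD : 0 ≤ D)
    (h' : SeqBoundedBy T U ψ D) (h : SeqBoundedBy S T φ C) :
    SeqBoundedBy S U (ψ ∘ₗ φ) (D * C) := by
  intro n x
  rw [mul_assoc]
  exact (h' n fun i => φ (x i)).trans (mul_le_mul_of_nonneg_left (h n x) hD)

/-- The linear space `SB(X, Y)` of sequentially bounded operators. -/
def SB (S : OpSeqStructure E) (T : OpSeqStructure F) : Submodule ℂ (E →ₗ[ℂ] F) where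
  carrier := {φ | SeqBounded S T φ}
  zero_mem' := ⟨0, le_rfl, fun n x => by
    have : (fun i => (0 : E →ₗ[ℂ] F) (x i)) = 0 := by funext i; simp
    rw [this]; simp⟩
  add_mem' := by
    rintro φ ψ ⟨C, hC, h⟩ ⟨D, hD, h'⟩
    exact ⟨C + D, by positivity, h.add h'⟩
  smul_mem' := by
    rintro c φ ⟨C, hC, h⟩
    exact ⟨‖c‖ * C, by positivity, h.smul c⟩

end SB

/-! ### The sequential dual -/

section Dual

variable {E : Type u} [AddCommGroup E] [Module ℂ E]

/-- A column `f` of functionals, as the operator `x ↦ (f i x)ᵢ` into the Hilbert space `ℂⁿ = ℓ₂ⁿ`. -/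
def columnFunctional {n : ℕ} (f : Fin n → (E →ₗ[ℂ] ℂ)) : E →ₗ[ℂ] EuclideanSpace ℂ (Fin n) :=
  (WithLp.linearEquiv 2 ℂ (Fin n → ℂ)).symm.toLinearMap ∘ₗ LinearMap.pi f

@[simp] theorem columnFunctional_apply {n : ℕ} (f : Fin n → (E →ₗ[ℂ] ℂ)) (x : E) (i : Fin n) :
    columnFunctional f x i = f i x := rfl

theorem columnFunctional_norm_sq {n k : ℕ} (f : Fin n → (E →ₗ[ℂ] ℂ)) (x : Fin k → E) :
    (hilbert (EuclideanSpace ℂ (Fin n))).norm k (fun j => columnFunctional f (x j)) ^ 2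
      = ∑ i, (hilbert ℂ).norm k (fun j => f i (x j)) ^ 2 := by
  simp_rw [hilbert_norm_sq, EuclideanSpace.norm_sq_eq, columnFunctional_apply]
  rw [Finset.sum_comm]

theorem columnFunctional_seqBounded {S : OpSeqStructure E} {n : ℕ}
    (f : Fin n → SB S (hilbert ℂ)) :
    SeqBounded S (hilbert (EuclideanSpace ℂ (Fin n))) (columnFunctional fun i => (f i).1) := by
  refine ⟨√(∑ i, sbNorm S (hilbert ℂ) (f i).1 ^ 2), by positivity, fun k x => ?_⟩
  refine le_of_sq_le_sq ?_ (by positivity)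
  rw [columnFunctional_norm_sq, mul_pow, Real.sq_sqrt (by positivity), Finset.sum_mul]
  refine Finset.sum_le_sum fun i _ => ?_
  rw [← mul_pow]
  exact pow_le_pow_left₀ (apply_nonneg _ _) (SeqBounded.le_sbNorm (f i).2 k x) 2

/-- The norm on columns of height `n` in `SB(X, ℂ)`, given by the identification
`SB(X, ℂ)ⁿ = SB(X, ℂⁿ)`; here `ℂ`, and hence its amplification `ℂⁿ = ℓ₂ⁿ`, carries the standard
structure of a Hilbert space. -/
def dualNorm (S : OpSeqStructure E) (n : ℕ) (f : Fin n → SB S (hilbert ℂ)) : ℝ :=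
  sbNorm S (hilbert (EuclideanSpace ℂ (Fin n))) (columnFunctional fun i => (f i).1)

section

variable {S : OpSeqStructure E} {n m : ℕ}

theorem dualNorm_nonneg (f : Fin n → SB S (hilbert ℂ)) : 0 ≤ dualNorm S n f := sbNorm_nonneg _

theorem le_dualNorm (f : Fin n → SB S (hilbert ℂ)) :
    SeqBoundedBy S (hilbert (EuclideanSpace ℂ (Fin n))) (columnFunctional fun i => (f i).1)
      (dualNorm S n f) :=
  (columnFunctional_seqBounded f).le_sbNorm

theorem dualNorm_le {f : Fin n → SB S (hilbert ℂ)} {C : ℝ} (hC : 0 ≤ C)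
    (h : SeqBoundedBy S (hilbert (EuclideanSpace ℂ (Fin n)))
      (columnFunctional fun i => (f i).1) C) : dualNorm S n f ≤ C :=
  sbNorm_le hC h

theorem le_dualNorm_sq (f : Fin n → SB S (hilbert ℂ)) {k : ℕ} (x : Fin k → E) :
    ∑ i, (hilbert ℂ).norm k (fun j => (f i).1 (x j)) ^ 2
      ≤ dualNorm S n f ^ 2 * S.norm k x ^ 2 := by
  rw [← columnFunctional_norm_sq, ← mul_pow]
  exact pow_le_pow_left₀ (apply_nonneg _ _) (le_dualNorm f k x) 2

theorem dualNorm_le_of_sq {f : Fin n → SB S (hilbert ℂ)} {C : ℝ} (hC : 0 ≤ C)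
    (h : ∀ (k : ℕ) (x : Fin k → E), ∑ i, (hilbert ℂ).norm k (fun j => (f i).1 (x j)) ^ 2
      ≤ C ^ 2 * S.norm k x ^ 2) : dualNorm S n f ≤ C := by
  refine dualNorm_le hC fun k x => ?_
  refine le_of_sq_le_sq ?_ (mul_nonneg hC (apply_nonneg _ _))
  rw [columnFunctional_norm_sq, mul_pow]
  exact h k x

theorem dualNorm_add_le (f g : Fin n → SB S (hilbert ℂ)) :
    dualNorm S n (f + g) ≤ dualNorm S n f + dualNorm S n g := by
  refine dualNorm_le (add_nonneg (dualNorm_nonneg f) (dualNorm_nonneg g)) ?_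
  have e : (columnFunctional fun i => ((f + g) i).1)
      = (columnFunctional fun i => (f i).1) + columnFunctional fun i => (g i).1 := by
    ext x i
    simp
  rw [e]
  exact (le_dualNorm f).add (le_dualNorm g)

theorem dualNorm_smul_le (c : ℂ) (f : Fin n → SB S (hilbert ℂ)) :
    dualNorm S n (c • f) ≤ ‖c‖ * dualNorm S n f := by
  refine dualNorm_le (mul_nonneg (norm_nonneg c) (dualNorm_nonneg f)) ?_
  have e : (columnFunctional fun i => ((c • f) i).1)
      = c • columnFunctional fun i => (f i).1 := by
    ext x i
    simp
  rw [e]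
  exact (le_dualNorm f).smul c

theorem dualNorm_zero : dualNorm S n (0 : Fin n → SB S (hilbert ℂ)) = 0 := by
  refine le_antisymm ?_ (dualNorm_nonneg _)
  simpa using dualNorm_smul_le (0 : ℂ) (0 : Fin n → SB S (hilbert ℂ))

theorem eq_zero_of_dualNorm_eq_zero {f : Fin n → SB S (hilbert ℂ)} (hf : dualNorm S n f = 0) :
    f = 0 := by
  funext i
  apply Subtype.ext
  ext x
  have h := le_dualNorm_sq f (k := 1) fun _ => x
  rw [hf] at h
  simp_rw [hilbert_norm_sq] at h
  have h' := (Finset.single_le_sum (f := fun i => ∑ _j : Fin 1, ‖(f i).1 x‖ ^ 2)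
    (fun _ _ => by positivity) (Finset.mem_univ i)).trans h
  have h2 : ‖(f i).1 x‖ ^ 2 ≤ 0 := by simpa using h'
  have h3 : ‖(f i).1 x‖ = 0 := by nlinarith [norm_nonneg ((f i).1 x)]
  simpa using h3

theorem dualNorm_matAct_le (α : Matrix (Fin m) (Fin n) ℂ) (f : Fin n → SB S (hilbert ℂ)) :
    dualNorm S m (matAct α f) ≤ ‖α‖ * dualNorm S n f := by
  refine dualNorm_le_of_sq (mul_nonneg (norm_nonneg α) (dualNorm_nonneg f)) fun k x => ?_
  rw [mul_pow, mul_assoc]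
  refine le_trans ?_ (mul_le_mul_of_nonneg_left (le_dualNorm_sq f x) (sq_nonneg ‖α‖))
  simp_rw [hilbert_norm_sq]
  rw [Finset.sum_comm, Finset.sum_comm (s := (Finset.univ : Finset (Fin n))), Finset.mul_sum]
  refine Finset.sum_le_sum fun j _ => ?_
  have h := matAct_sq_le_euclidean α fun i => (f i).1 (x j)
  have e : ∀ i, (matAct α f i).1 (x j) = ∑ l, α i l * (f l).1 (x j) := by
    intro i
    simp [matAct]
  simp_rw [e]
  exact h

theorem dualNorm_append_sq_le (f : Fin n → SB S (hilbert ℂ)) (g : Fin m → SB S (hilbert ℂ)) :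
    dualNorm S (n + m) (Fin.append f g) ^ 2 ≤ dualNorm S n f ^ 2 + dualNorm S m g ^ 2 := by
  have h : dualNorm S (n + m) (Fin.append f g) ≤ √(dualNorm S n f ^ 2 + dualNorm S m g ^ 2) := by
    refine dualNorm_le_of_sq (Real.sqrt_nonneg _) fun k x => ?_
    rw [Real.sq_sqrt (by positivity), Fin.sum_univ_add, add_mul]
    simp_rw [Fin.append_left, Fin.append_right]
    exact add_le_add (le_dualNorm_sq f x) (le_dualNorm_sq g x)
  calc dualNorm S (n + m) (Fin.append f g) ^ 2
      ≤ √(dualNorm S n f ^ 2 + dualNorm S m g ^ 2) ^ 2 := pow_le_pow_left₀ (dualNorm_nonneg _) h 2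
    _ = _ := Real.sq_sqrt (by positivity)

end

/-- The operator sequence structure of the sequential dual `SB(X, ℂ)`. -/
def dualStructure (S : OpSeqStructure E) : OpSeqStructure (SB S (hilbert ℂ)) where
  norm n := Seminorm.ofSMulLE (dualNorm S n) dualNorm_zero dualNorm_add_le dualNorm_smul_le
  eq_zero_of_norm_eq_zero _ _ hf := eq_zero_of_dualNorm_eq_zero hf
  norm_matAct_le _ _ α f := dualNorm_matAct_le α f
  norm_append_sq_le _ _ f g := dualNorm_append_sq_le f g

end Dual

/-! ### The category `SQNor` -/

/-- Operator sequence spaces. -/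
structure SQNor : Type (u + 1) where
  /-- the underlying linear space -/
  carrier : Type u
  [addCommGroup : AddCommGroup carrier]
  [module : Module ℂ carrier]
  /-- the norms of the amplifications -/
  str : OpSeqStructure carrier

attribute [instance] SQNor.addCommGroup SQNor.module

/-- `SQNor`: operator sequence spaces and sequentially bounded operators. -/
instance : Category.{u} SQNor.{u} where
  Hom X Y := SB X.str Y.str
  id X := ⟨LinearMap.id, 1, zero_le_one, fun n x => by simp⟩
  comp φ ψ := ⟨ψ.1 ∘ₗ φ.1, by
    obtain ⟨C, hC, h⟩ := φ.2
    obtain ⟨D, hD, h'⟩ := ψ.2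
    exact ⟨D * C, by positivity, h'.comp hD h⟩⟩

/-- `min(E)` as an object of `SQNor`. -/
def minSpace (E : Type u) [NormedAddCommGroup E] [NormedSpace ℂ E] : SQNor.{u} :=
  ⟨E, minStructure E⟩

/-- The sequential dual of an operator sequence space. -/
def SQNor.dual (X : SQNor.{u}) : SQNor.{u} := ⟨SB X.str (hilbert ℂ), dualStructure X.str⟩

theorem SeqBoundedBy.adjoint {E F : Type u} [AddCommGroup E] [Module ℂ E] [AddCommGroup F]
    [Module ℂ F] {S : OpSeqStructure E} {T : OpSeqStructure F} {φ : E →ₗ[ℂ] F} {C : ℝ}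
    (hC : 0 ≤ C) (h : SeqBoundedBy S T φ C) {n : ℕ} (f : Fin n → SB T (hilbert ℂ))
    (g : Fin n → SB S (hilbert ℂ)) (hg : ∀ i x, (g i).1 x = (f i).1 (φ x)) :
    dualNorm S n g ≤ C * dualNorm T n f := by
  refine dualNorm_le_of_sq (mul_nonneg hC (dualNorm_nonneg f)) fun k x => ?_
  simp_rw [hg]
  refine (le_dualNorm_sq f fun j => φ (x j)).trans ?_
  rw [mul_comm C, mul_pow, mul_assoc, ← mul_pow C]
  exact mul_le_mul_of_nonneg_left (pow_le_pow_left₀ (apply_nonneg _ _) (h k x) 2) (sq_nonneg _)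

/-- The adjoint `f ↦ f ∘ φ` of a sequentially bounded operator, as a morphism of sequential duals. -/
def SQNor.dualMap {X Y : SQNor.{u}} (φ : X ⟶ Y) : Y.dual ⟶ X.dual :=
  ⟨{ toFun := fun f => ⟨f.1 ∘ₗ φ.1, by
        obtain ⟨C, hC, h⟩ := φ.2
        obtain ⟨D, hD, h'⟩ := f.2
        exact ⟨D * C, by positivity, h'.comp hD h⟩⟩
     map_add' := fun _ _ => rfl
     map_smul' := fun _ _ => rfl }, by
    obtain ⟨C, hC, h⟩ := φ.2
    exact ⟨C, hC, fun n f => h.adjoint hC f _ fun _ _ => rfl⟩⟩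

/-- The contravariant duality functor on `SQNor`. -/
def dualFunctor : SQNor.{u}ᵒᵖ ⥤ SQNor.{u} where
  obj X := X.unop.dual
  map φ := SQNor.dualMap φ.unop

/-! ### The category `Nor₀` of semilinear normed spaces -/

/-- Semilinear normed spaces over `ℂ`: sets with a zero vector and an action of the multiplicative
monoid of `ℂ` such that `0 • x = 0` (there is no addition), together with a norm. -/
structure Nor0 : Type (u + 1) where
  /-- the set of vectors -/
  carrier : Type u
  [zero : Zero carrier]
  [action : MulActionWithZero ℂ carrier]
  /-- the norm -/
  norm : carrier → ℝ
  norm_nonneg : ∀ x, 0 ≤ norm x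
  eq_zero_of_norm_eq_zero : ∀ x, norm x = 0 → x = 0
  norm_smul : ∀ (c : ℂ) (x : carrier), norm (c • x) = ‖c‖ * norm x

attribute [instance] Nor0.zero Nor0.action

/-- Bounded semilinear operators: homogeneous maps `φ` with `‖φ x‖ ≤ C ‖x‖` for some `C`. -/
@[ext] structure Nor0.Hom (V W : Nor0.{u}) : Type u where
  /-- the underlying map -/
  toFun : V.carrier → W.carrier
  map_smul : ∀ (c : ℂ) (x : V.carrier), toFun (c • x) = c • toFun x
  bounded : ∃ C : ℝ, 0 ≤ C ∧ ∀ x, W.norm (toFun x) ≤ C * V.norm x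

/-- `Nor₀`: semilinear normed spaces and bounded semilinear operators. -/
instance : Category.{u} Nor0.{u} where
  Hom := Nor0.Hom
  id V := ⟨id, fun _ _ => rfl, 1, zero_le_one, fun _ => (one_mul _).ge⟩
  comp φ ψ := ⟨ψ.toFun ∘ φ.toFun, fun c x => by simp [φ.map_smul, ψ.map_smul], by
    obtain ⟨C, hC, h⟩ := φ.bounded
    obtain ⟨D, hD, h'⟩ := ψ.bounded
    refine ⟨D * C, by positivity, fun x => (h' _).trans ?_⟩
    rw [mul_assoc]
    exact mul_le_mul_of_nonneg_left (h x) hD⟩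

/-- The underlying semilinear normed space of the first amplification of `X`, where `E¹` is
identified with `E`. -/
def firstAmpl (X : SQNor.{u}) : Nor0.{u} where
  carrier := X.carrier
  norm x := X.str.norm 1 fun _ => x
  norm_nonneg _ := apply_nonneg _ _
  eq_zero_of_norm_eq_zero _ hx := congrFun (X.str.eq_zero_of_norm_eq_zero 1 _ hx) 0
  norm_smul c x := map_smul_eq_mul (X.str.norm 1) c fun _ => x

/-- The functor `SQNor ⥤ Nor₀` that takes an operator sequence space to the underlying semilinear
normed space of its first amplification, and leaves morphisms unchanged. -/
def firstAmplFunctor : SQNor.{u} ⥤ Nor0.{u} where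
  obj := firstAmpl
  map φ := ⟨fun x => φ.1 x, fun c x => map_smul φ.1 c x, by
    obtain ⟨C, hC, h⟩ := φ.2
    exact ⟨C, hC, fun x => h 1 fun _ => x⟩⟩

/-- The functor `SQNor ⥤ Nor₀ᵒᵖ`, `X ↦ (X^△)^(1)`, `φ ↦ φ^△`. -/
def pseudoTopDualFunctor : SQNor.{u} ⥤ Nor0.{u}ᵒᵖ :=
  (dualFunctor ⋙ firstAmplFunctor).rightOp

/-! ### Faithfulness of the functor -/

section Faithful

variable {E : Type u} [AddCommGroup E] [Module ℂ E]

theorem norm_sum_smul_le (S : OpSeqStructure E) {n : ℕ} (x : Fin n → E)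
    (ξ : EuclideanSpace ℂ (Fin n)) :
    S.norm 1 (fun _ => ∑ i, ξ i • x i) ≤ ‖ξ‖ * S.norm n x := by
  let α : Matrix (Fin 1) (Fin n) ℂ := fun _ j => ξ j
  have h1 : ‖α‖ ≤ ‖ξ‖ := by
    rw [Matrix.l2_opNorm_def]
    refine ContinuousLinearMap.opNorm_le_bound _ (norm_nonneg ξ) fun η => ?_
    let ζ : EuclideanSpace ℂ (Fin n) := WithLp.toLp 2 fun i => star (ξ i)
    have hζ : ‖ζ‖ = ‖ξ‖ := by simp [EuclideanSpace.norm_eq, ζ]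
    have h := norm_inner_le_norm (𝕜 := ℂ) ζ η
    rw [hζ] at h
    refine le_trans (le_of_eq ?_) h
    rw [EuclideanSpace.norm_eq]
    change √(∑ i, ‖(Matrix.mulVec α η) i‖ ^ 2) = _
    simp [α, ζ, PiLp.inner_apply, Matrix.mulVec, dotProduct, mul_comm]
  exact (S.norm_matAct_le 1 n α x).trans (mul_le_mul_of_nonneg_right h1 (apply_nonneg _ _))

/-- A functional that is bounded on `X^(1)` is sequentially bounded. -/
theorem seqBounded_of_bounded (S : OpSeqStructure E) (f : E →ₗ[ℂ] ℂ) {C : ℝ} (hC : 0 ≤ C)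
    (h : ∀ x, ‖f x‖ ≤ C * S.norm 1 fun _ => x) : SeqBounded S (hilbert ℂ) f := by
  refine ⟨C, hC, fun n x => ?_⟩
  have hN := apply_nonneg (S.norm n) x
  let ξ : EuclideanSpace ℂ (Fin n) := WithLp.toLp 2 fun i => star (f (x i))
  have hξ : (hilbert ℂ).norm n (fun i => f (x i)) = ‖ξ‖ := by
    rw [← sq_eq_sq₀ (apply_nonneg _ _) (norm_nonneg _), hilbert_norm_sq, EuclideanSpace.norm_sq_eq]
    simp [ξ]
  have h1 : f (∑ i, ξ i • x i) = ((‖ξ‖ ^ 2 : ℝ) : ℂ) := by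
    rw [EuclideanSpace.norm_sq_eq]
    simp [ξ, ← Complex.normSq_eq_norm_sq, Complex.normSq_eq_conj_mul_self]
  have h2 : ‖ξ‖ ^ 2 ≤ C * (‖ξ‖ * S.norm n x) := by
    have h3 := h (∑ i, ξ i • x i)
    rw [h1, Complex.norm_real, Real.norm_of_nonneg (by positivity)] at h3
    exact h3.trans (mul_le_mul_of_nonneg_left (norm_sum_smul_le S x ξ) hC)
  rw [hξ]
  rcases (norm_nonneg ξ).eq_or_lt with h0 | h0
  · rw [← h0]; positivity
  · refine le_of_mul_le_mul_left ?_ h0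
    linarith

/-- Sequentially bounded functionals separate points, by the Hahn--Banach theorem. -/
theorem exists_functional_ne_zero (S : OpSeqStructure E) {x : E} (hx : x ≠ 0) :
    ∃ f : SB S (hilbert ℂ), f.1 x ≠ 0 := by
  let : Norm E := ⟨fun y => S.norm 1 fun _ => y⟩
  have core : NormedSpace.Core ℂ E :=
    { norm_nonneg := fun y => apply_nonneg _ _
      norm_smul := fun c y => map_smul_eq_mul (S.norm 1) c fun _ => y
      norm_triangle := fun y z => map_add_le_add (S.norm 1) (fun _ => y) fun _ => z
      norm_eq_zero_iff := fun y => ⟨fun h => congrFun (S.eq_zero_of_norm_eq_zero 1 _ h) 0,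
        fun h => by subst h; exact map_zero (S.norm 1)⟩ }
  let : NormedAddCommGroup E := NormedAddCommGroup.ofCore core
  let : NormedSpace ℂ E := NormedSpace.ofCore core
  obtain ⟨g, -, hg⟩ := exists_dual_vector ℂ x (norm_ne_zero_iff.2 hx)
  refine ⟨⟨g.toLinearMap, seqBounded_of_bounded S g.toLinearMap (norm_nonneg g)
    fun y => g.le_opNorm y⟩, ?_⟩
  change g x ≠ 0
  rw [hg]
  exact Complex.ofReal_ne_zero.2 (norm_ne_zero_iff.2 hx)

end Faithful

instance : pseudoTopDualFunctor.{u}.Faithful where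
  map_injective {X Y} φ ψ h := by
    have h1 : firstAmplFunctor.map (SQNor.dualMap φ) = firstAmplFunctor.map (SQNor.dualMap ψ) :=
      Quiver.Hom.op_inj h
    apply Subtype.ext
    ext x
    by_contra hne
    obtain ⟨f, hf⟩ := exists_functional_ne_zero Y.str (sub_ne_zero.2 hne)
    have h2 := congrArg (fun k : Nor0.Hom _ _ => k.toFun f) h1
    have h3 : f.1 (φ.1 x) = f.1 (ψ.1 x) := congrArg (fun g : SB X.str (hilbert ℂ) => g.1 x) h2
    exact hf (by rw [map_sub, h3, sub_self])

/-! ### Cofree objects -/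

/-- `F` is cofree with base `M` for a faithful functor `R : K ⥤ L`. -/
def IsCofreeWithBase {K : Type*} [Category* K] {L : Type*} [Category* L] (R : K ⥤ L) [R.Faithful]
    (F : K) (M : L) : Prop :=
  ∃ j : R.obj F ⟶ M, ∀ (X : K) (φ : R.obj X ⟶ M), ∃! ψ : X ⟶ F, R.map ψ ≫ j = φ

/-- `X` is pseudotopologically cofree: cofree, with some base, for `X ↦ (X^△)^(1)`. -/
def IsPseudoTopCofree (X : SQNor.{u}) : Prop :=
  ∃ M : Nor0.{u}ᵒᵖ, IsCofreeWithBase pseudoTopDualFunctor.{u} X M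

/-- `X` and `Y` are sequentially topologically isomorphic: isomorphic in `SQNor`. -/
def SeqTopIsomorphic (X Y : SQNor.{u}) : Prop := Nonempty (X ≅ Y)

/-- `min(ℓ_∞(Λ))`. -/
def minLInfty (Λ : Type u) : SQNor.{u} := minSpace (lp (fun _ : Λ => ℂ) ∞)

end SQ

end

namespace SQ

/-! ### Cofree objects in general -/

section Cofree

variable {K : Type*} [Category* K] {L : Type*} [Category* L] {R : K ⥤ L} [R.Faithful]
  {F G : K} {M : L}

/-! A morphism `□(X) → M` in the opposite category is a homogeneous bounded map `M → (X^△)^(1)`, and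
additivity is not required of it. Such a map is therefore known as soon as it is known at one point
of each orbit of nonzero scalars. If `c • x = x` with `c ≠ 1`, the image of `x` must vanish, because
the target is a linear space. On the remaining, free orbits the values at unit representatives `e
l`, `l ∈ Λ`, can be prescribed at will, subject only to a uniform bound. So these morphisms are
exactly the bounded families `(f l)` in `X^△` (`exists_isFrame`, `IsFrame.hom_ext`,
`IsFrame.exists_hom`).

A bounded family of functionals is the same as an operator `x ↦ (f l x)` to `ℓ_∞(Λ)` bounded on the
first amplification, and for the minimal structure this already gives sequential boundedness
(`seqBoundedBy_min_of_bounded`). Hence `min(ℓ_∞(Λ))` is cofree with base `M`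
(`IsFrame.isCofreeWithBase`).

Cofree objects over one base are isomorphic, so every cofree space has this form. Conversely, every
`Λ` indexes a frame of some `M`, namely of the union of `Λ` many complex lines glued at zero
(`isFrame_rays`), and cofreeness passes along isomorphisms. -/

theorem IsCofreeWithBase.of_iso (i : F ≅ G) (h : IsCofreeWithBase R G M) :
    IsCofreeWithBase R F M := by
  obtain ⟨j, hj⟩ := h
  refine ⟨R.map i.hom ≫ j, fun X φ => ?_⟩
  obtain ⟨ψ, hψ, huniq⟩ := hj X φ
  refine ⟨ψ ≫ i.inv, by simpa [← R.map_comp_assoc] using hψ, fun χ hχ => ?_⟩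
  rw [← huniq (χ ≫ i.hom) (by simpa using hχ)]
  simp

/-- Cofree objects with the same base are isomorphic. -/
theorem IsCofreeWithBase.nonempty_iso (hF : IsCofreeWithBase R F M)
    (hG : IsCofreeWithBase R G M) : Nonempty (F ≅ G) := by
  obtain ⟨j, hj⟩ := hF
  obtain ⟨k, hk⟩ := hG
  obtain ⟨a, ha, -⟩ := hk F j
  obtain ⟨b, hb, -⟩ := hj G k
  exact ⟨⟨a, b, (hj F j).unique (by simp [hb, ha]) (by simp),
    (hk G k).unique (by simp [hb, ha]) (by simp)⟩⟩

end Cofree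

/-! ### Frames of semilinear normed spaces -/

/-- A family of unit vectors that meets every free orbit of the scalar action exactly in one point
of the unit sphere, and meets no other nonzero orbits. -/
structure IsFrame (M : Nor0.{u}) {Λ : Type u} (e : Λ → M.carrier) : Prop where
  norm_eq_one : ∀ l, M.norm (e l) = 1
  index_eq : ∀ {l l' : Λ} {c c' : ℂ}, c • e l = c' • e l' → c ≠ 0 → l = l'
  scalar_eq : ∀ {l : Λ} {c c' : ℂ}, c • e l = c' • e l → c = c'
  -- The zero vector always falls under the second alternative, with `c = 0`; this matters when `Λ`
  -- is empty.
  exists_eq_or : ∀ x, (∃ (l : Λ) (c : ℂ), x = c • e l) ∨ ∃ c : ℂ, c ≠ 1 ∧ c • x = x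

theorem Nor0.norm_zero (M : Nor0.{u}) : M.norm 0 = 0 := by
  simpa using M.norm_smul 0 0

namespace IsFrame

variable {M : Nor0.{u}} {Λ : Type u} {e : Λ → M.carrier}

/-- Morphisms to a linear space are determined by their values on a frame. -/
theorem hom_ext (he : IsFrame M e) {W : SQNor.{u}} {φ ψ : Nor0.Hom M (firstAmpl W)}
    (h : ∀ l, φ.toFun (e l) = ψ.toFun (e l)) : φ = ψ := by
  -- A vector fixed by some `c ≠ 1` has an image `w` with `(c - 1) • w = 0`, so every morphism kills
  -- it.
  have key : ∀ (χ : Nor0.Hom M (firstAmpl W)) (x : M.carrier) (c : ℂ), c ≠ 1 → c • x = x →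
      χ.toFun x = 0 := by
    intro χ x c hc hx
    have h1 : c • (χ.toFun x : W.carrier) = (χ.toFun x : W.carrier) :=
      (χ.map_smul c x).symm.trans (congrArg χ.toFun hx)
    have h2 : ∀ w : W.carrier, c • w = w → w = 0 := fun w hw => by
      have h3 : (c - 1) • w = 0 := by rw [sub_smul, hw, one_smul, sub_self]
      exact (smul_eq_zero.1 h3).resolve_left (sub_ne_zero.2 hc)
    exact h2 _ h1
  apply Nor0.Hom.ext
  funext x
  rcases he.exists_eq_or x with ⟨l, c, rfl⟩ | ⟨c, hc, hx⟩
  · rw [φ.map_smul, ψ.map_smul, h]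
  · rw [key φ x c hc hx, key ψ x c hc hx]

open Classical in
/-- The homogeneous extension of a map on a frame, zero on the nonfree orbits. -/
noncomputable def extend {W : Type u} [AddCommGroup W] [Module ℂ W] (e : Λ → M.carrier) (g : Λ → W)
    (x : M.carrier) : W :=
  if h : ∃ (l : Λ) (c : ℂ), x = c • e l then h.choose_spec.choose • g h.choose else 0

/-- The chosen representation of the vector does not matter. A nonzero multiple of a frame vector
determines both index and scalar; for the zero vector the index is ambiguous, but comparing norms
forces the scalar to be `0`. -/
theorem extend_smul_frame (he : IsFrame M e) {W : Type u} [AddCommGroup W] [Module ℂ W]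
    (g : Λ → W) (l : Λ) (c : ℂ) : extend e g (c • e l) = c • g l := by
  have h : ∃ (l' : Λ) (c' : ℂ), c • e l = c' • e l' := ⟨l, c, rfl⟩
  rw [extend, dif_pos h]
  have hs := h.choose_spec.choose_spec
  generalize h.choose_spec.choose = c' at hs ⊢
  generalize h.choose = l' at hs ⊢
  by_cases hc : c = 0
  · subst hc
    have h0 := congrArg M.norm hs
    rw [M.norm_smul, M.norm_smul, he.norm_eq_one, he.norm_eq_one] at h0
    have : c' = 0 := by simpa using h0.symm
    simp [this]
  · obtain rfl := he.index_eq hs hc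
    rw [he.scalar_eq hs]

/-- Bounded families in a linear space extend from a frame to morphisms. -/
theorem exists_hom (he : IsFrame M e) (W : SQNor.{u}) (g : Λ → W.carrier) {C : ℝ} (hC : 0 ≤ C)
    (hg : ∀ l, (firstAmpl W).norm (g l) ≤ C) :
    ∃ φ : Nor0.Hom M (firstAmpl W), ∀ l, φ.toFun (e l) = g l := by
  have hzero : ∀ x, (¬ ∃ (l : Λ) (c : ℂ), x = c • e l) → extend e g x = 0 :=
    fun x hx => dif_neg hx
  refine ⟨⟨extend (W := W.carrier) e g, fun c x => ?_, C, hC, fun x => ?_⟩, fun l => ?_⟩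
  · change extend e g (c • x) = c • extend e g x
    by_cases hx : ∃ (l : Λ) (b : ℂ), x = b • e l
    · obtain ⟨l, b, rfl⟩ := hx
      rw [smul_smul, he.extend_smul_frame, he.extend_smul_frame, mul_smul]
    · rw [hzero x hx, smul_zero]
      -- The complement of the multiples of frame vectors is stable under nonzero scalars, so `c •
      -- x` can return to them only for `c = 0`, where the extension vanishes anyway.
      by_cases hc : c • x ∈ Set.range fun p : Λ × ℂ => p.2 • e p.1
      · obtain ⟨⟨l, b⟩, hb⟩ := hc
        dsimp only at hb
        by_cases h0 : c = 0
        · have hb0 : b = 0 := by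
            have h1 := congrArg M.norm hb
            rw [h0, zero_smul, M.norm_zero, M.norm_smul, he.norm_eq_one] at h1
            simpa using h1
          rw [← hb, he.extend_smul_frame, hb0, zero_smul]
        · refine absurd ⟨l, c⁻¹ * b, ?_⟩ hx
          rw [mul_smul, hb, smul_smul, inv_mul_cancel₀ h0, one_smul]
      · exact hzero _ fun ⟨l, b, hb⟩ => hc ⟨(l, b), hb.symm⟩
  · by_cases hx : ∃ (l : Λ) (b : ℂ), x = b • e l
    · obtain ⟨l, b, rfl⟩ := hx
      rw [he.extend_smul_frame, M.norm_smul, he.norm_eq_one]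
      have h1 : (firstAmpl W).norm (b • g l) = ‖b‖ * (firstAmpl W).norm (g l) :=
        (firstAmpl W).norm_smul b (g l)
      rw [h1, mul_one, mul_comm]
      exact mul_le_mul_of_nonneg_right (hg l) (norm_nonneg b)
    · rw [hzero x hx]
      have h1 : (firstAmpl W).norm (0 : W.carrier) = 0 := (firstAmpl W).norm_zero
      rw [h1]
      exact mul_nonneg hC (M.norm_nonneg x)
  · have h := he.extend_smul_frame g l 1
    rw [one_smul, one_smul] at h
    exact h

end IsFrame

/-- Every semilinear normed space has a frame. -/
theorem exists_isFrame (M : Nor0.{u}) :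
    ∃ (Λ : Type u) (e : Λ → M.carrier), IsFrame M e := by
  let Q := MulAction.orbitRel.Quotient ℂˣ M.carrier
  -- The scalar `c = 0` is included, so a free vector is nonzero and can be divided by its norm.
  let Free : M.carrier → Prop := fun x => ∀ c : ℂ, c • x = x → c = 1
  let Λ := {q : Q // Free q.out}
  let r : Λ → M.carrier := fun q => q.1.out
  have hr0 : ∀ q, M.norm (r q) ≠ 0 := by
    intro q h
    have h1 : r q = 0 := M.eq_zero_of_norm_eq_zero _ h
    have h2 : (0 : ℂ) = 1 := q.2 0 (by change (0 : ℂ) • r q = r q; rw [h1, smul_zero])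
    exact zero_ne_one h2
  have hinj : ∀ (q : Λ) (a b : ℂ), b ≠ 0 → a • r q = b • r q → a = b := by
    intro q a b hb h
    have h1 := q.2 (b⁻¹ * a) (by
      change (b⁻¹ * a) • r q = r q
      rw [mul_smul, h, smul_smul, inv_mul_cancel₀ hb, one_smul])
    field_simp at h1
    exact h1
  have hn0 : ∀ q, ((M.norm (r q) : ℂ))⁻¹ ≠ 0 := fun q =>
    inv_ne_zero (Complex.ofReal_ne_zero.2 (hr0 q))
  -- Nonzero multiples stay in the orbit, so the index `q` can be recovered from them. This gives
  -- `index_eq`.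
  have hmk : ∀ (q : Λ) (c : ℂ), c ≠ 0 → (Quotient.mk'' (c • r q) : Q) = q.1 := by
    intro q c hc
    have h1 : (Quotient.mk'' (r q) : Q) = q.1 := Quotient.out_eq' q.1
    rw [← h1]
    exact Quotient.sound' ⟨Units.mk0 c hc, rfl⟩
  have hunit : ∀ q, M.norm ((M.norm (r q) : ℂ)⁻¹ • r q) = 1 := by
    intro q
    rw [M.norm_smul, norm_inv, Complex.norm_real, Real.norm_of_nonneg (M.norm_nonneg _),
      inv_mul_cancel₀ (hr0 q)]
  refine ⟨Λ, fun q => (M.norm (r q) : ℂ)⁻¹ • r q, hunit, ?_, ?_, ?_⟩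
  · intro l l' c c' h hc
    have hc' : c' ≠ 0 := by
      rintro rfl
      have h1 := congrArg M.norm h
      rw [zero_smul, M.norm_zero, M.norm_smul, hunit] at h1
      exact hc (by simpa using h1)
    simp only [smul_smul] at h
    apply Subtype.ext
    rw [← hmk l _ (mul_ne_zero hc (hn0 l)), h, hmk l' _ (mul_ne_zero hc' (hn0 l'))]
  · intro l c c' h
    by_cases hc' : c' = 0
    · subst hc'
      have h1 := congrArg M.norm h
      rw [zero_smul, M.norm_zero, M.norm_smul, hunit] at h1
      simpa using h1
    · simp only [smul_smul] at h
      exact mul_right_cancel₀ (hn0 l) (hinj l _ _ (mul_ne_zero hc' (hn0 l)) h)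
  · intro x
    by_cases hx : Free x
    · left
      obtain ⟨v, hv⟩ : ∃ v : ℂˣ, v • x = (Quotient.mk'' x : Q).out :=
        Quotient.exact' (Quotient.out_eq' (Quotient.mk'' x : Q))
      have hv' : (v : ℂ) • x = (Quotient.mk'' x : Q).out := hv
      -- Scalars commute, so all points of an orbit have the same stabilizer, and freeness passes
      -- from `x` to the chosen representative.
      have hfree : Free (Quotient.mk'' x : Q).out := by
        intro c hc
        rw [← hv', smul_smul] at hc
        refine hx c ?_
        have h1 := congrArg (fun y => ((v⁻¹ : ℂˣ) : ℂ) • y) hc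
        rw [smul_smul, smul_smul, Units.inv_mul, one_smul, mul_comm c, ← mul_assoc,
          Units.inv_mul, one_mul] at h1
        exact h1
      let q : Λ := ⟨Quotient.mk'' x, hfree⟩
      -- The factor `M.norm (r q)` undoes the normalization, and `v⁻¹` moves the representative back
      -- to `x`.
      refine ⟨q, ((v⁻¹ : ℂˣ) : ℂ) * M.norm (r q), ?_⟩
      have h2 : (v : ℂ) • x = r q := hv'
      rw [smul_smul, mul_assoc, mul_inv_cancel₀ (Complex.ofReal_ne_zero.2 (hr0 q)), mul_one, ← h2,
        smul_smul, Units.inv_mul, one_smul]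
    · right
      simp only [Free, not_forall] at hx
      obtain ⟨c, h, hc⟩ := hx
      exact ⟨c, hc, h⟩

/-- The set of multiples of the standard unit vectors in `ℂ^(Λ)`. -/
def Rays (Λ : Type u) : Type u := {f : Λ →₀ ℂ // f = 0 ∨ ∃ l c, f = Finsupp.single l c}

instance (Λ : Type u) : Zero (Rays Λ) := ⟨⟨0, Or.inl rfl⟩⟩

noncomputable instance (Λ : Type u) : MulActionWithZero ℂ (Rays Λ) where
  smul c f := ⟨c • f.1, by
    obtain h | ⟨l, b, h⟩ := f.2
    · exact Or.inl (by rw [h, smul_zero])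
    · exact Or.inr ⟨l, c * b, by rw [h, Finsupp.smul_single, smul_eq_mul]⟩⟩
  one_smul f := Subtype.ext (one_smul ℂ f.1)
  mul_smul a b f := Subtype.ext (mul_smul a b f.1)
  smul_zero a := Subtype.ext (smul_zero a)
  zero_smul f := Subtype.ext (zero_smul ℂ f.1)

/-- The semilinear normed space of multiples of the standard unit vectors in `ℂ^(Λ)`. -/
noncomputable def rays (Λ : Type u) : Nor0.{u} where
  carrier := Rays Λ
  -- There is at most one term, so `single l c` has norm `‖c‖`; summing over the support avoids
  -- choosing `l`.
  norm f := ∑ l ∈ f.1.support, ‖f.1 l‖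
  norm_nonneg f := Finset.sum_nonneg fun _ _ => norm_nonneg _
  eq_zero_of_norm_eq_zero f hf := by
    apply Subtype.ext
    ext l
    change f.1 l = 0
    by_contra hl
    have h := (Finset.sum_eq_zero_iff_of_nonneg fun _ _ => norm_nonneg _).1 hf l
      (Finsupp.mem_support_iff.2 hl)
    exact hl (norm_eq_zero.1 h)
  norm_smul c f := by
    rw [Finset.mul_sum]
    change ∑ l ∈ (c • f.1).support, ‖(c • f.1) l‖ = _
    rw [Finset.sum_subset Finsupp.support_smul fun l _ hl => by
      rw [Finsupp.notMem_support_iff.1 hl, norm_zero]]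
    simp

/-- This provides, for an arbitrary `Λ`, a base over which `min(ℓ_∞(Λ))` is cofree. -/
theorem isFrame_rays (Λ : Type u) :
    IsFrame (rays Λ) fun l => (⟨Finsupp.single l 1, Or.inr ⟨l, 1, rfl⟩⟩ : Rays Λ) := by
  have hsmul : ∀ (l : Λ) (c : ℂ), c • Finsupp.single l (1 : ℂ) = Finsupp.single l c := by simp
  refine ⟨fun l => ?_, fun {l l' c c'} h hc => ?_, fun {l c c'} h => ?_, fun x => ?_⟩
  · change ∑ i ∈ (Finsupp.single l (1 : ℂ)).support, ‖Finsupp.single l (1 : ℂ) i‖ = 1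
    rw [Finsupp.support_single _ one_ne_zero]
    simp
  · have h1 : c • Finsupp.single l (1 : ℂ) = c' • Finsupp.single l' (1 : ℂ) :=
      congrArg Subtype.val h
    rw [hsmul, hsmul] at h1
    obtain h2 | h2 := Finsupp.single_eq_single_iff _ _ _ _ |>.1 h1
    · exact h2.1
    · exact absurd h2.1 hc
  · have h1 : c • Finsupp.single l (1 : ℂ) = c' • Finsupp.single l (1 : ℂ) :=
      congrArg Subtype.val h
    rw [hsmul, hsmul] at h1
    exact Finsupp.single_injective l h1
  · obtain ⟨f, hf⟩ := x
    rcases hf with rfl | ⟨l, c, rfl⟩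
    -- Any scalar other than `1` fixes zero; `2` is an arbitrary choice.
    · exact Or.inr ⟨2, by norm_num, Subtype.ext (smul_zero (2 : ℂ))⟩
    · exact Or.inl ⟨l, c, Subtype.ext (hsmul l c).symm⟩

/-! ### Bounded families of functionals and operators to `min(ℓ_∞)` -/

/-- Self-duality of `ℓ₂ⁿ`: the bound is tested on the conjugate column `ξ = star y`, where the
pairing equals `‖ξ‖ ^ 2`, and one factor `‖ξ‖` is cancelled. -/
theorem hilbert_norm_le_of_forall {n : ℕ} {y : Fin n → ℂ} {A : ℝ}
    (h : ∀ ξ : EuclideanSpace ℂ (Fin n), ‖∑ i, ξ i * y i‖ ≤ A * ‖ξ‖) (hA : 0 ≤ A) :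
    (hilbert ℂ).norm n y ≤ A := by
  let ξ : EuclideanSpace ℂ (Fin n) := WithLp.toLp 2 fun i => star (y i)
  have hξ : (hilbert ℂ).norm n y = ‖ξ‖ := by
    rw [← sq_eq_sq₀ (apply_nonneg _ _) (norm_nonneg _), hilbert_norm_sq, EuclideanSpace.norm_sq_eq]
    simp [ξ]
  have h1 : ∑ i, ξ i * y i = ((‖ξ‖ ^ 2 : ℝ) : ℂ) := by
    rw [EuclideanSpace.norm_sq_eq]
    simp [ξ, ← Complex.normSq_eq_norm_sq, Complex.normSq_eq_conj_mul_self]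
  have h2 := h ξ
  rw [h1, Complex.norm_real, Real.norm_of_nonneg (by positivity)] at h2
  rw [hξ]
  rcases (norm_nonneg ξ).eq_or_lt with h0 | h0
  · rwa [← h0]
  · refine le_of_mul_le_mul_right ?_ h0
    linarith

theorem minStructure_norm {E : Type u} [NormedAddCommGroup E] [NormedSpace ℂ E] (n : ℕ)
    (x : Fin n → E) : (minStructure E).norm n x = ‖columnOperator n x‖ := rfl

/-- Pairing the column `(f (x i))` with `ξ` gives `f` at `columnOperator n x ξ`, and the norm of
that operator is by definition the minimal norm of `x`. -/
theorem seqBoundedBy_minStructure {E : Type u} [NormedAddCommGroup E] [NormedSpace ℂ E]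
    (f : E →L[ℂ] ℂ) : SeqBoundedBy (minStructure E) (hilbert ℂ) f.toLinearMap ‖f‖ := by
  intro n x
  refine hilbert_norm_le_of_forall (fun ξ => ?_) (mul_nonneg (norm_nonneg f) (apply_nonneg _ _))
  have h : ∑ i, ξ i * f.toLinearMap (x i) = f (columnOperator n x ξ) := by
    simp [columnOperator_apply]
  rw [h, minStructure_norm, mul_assoc]
  exact (f.le_opNorm _).trans
    (mul_le_mul_of_nonneg_left (ContinuousLinearMap.le_opNorm _ _) (norm_nonneg f))

theorem dualNorm_one_le {E : Type u} [AddCommGroup E] [Module ℂ E] {S : OpSeqStructure E}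
    {f : SB S (hilbert ℂ)} {C : ℝ} (hC : 0 ≤ C) (h : SeqBoundedBy S (hilbert ℂ) f.1 C) :
    dualNorm S 1 (fun _ => f) ≤ C := by
  refine dualNorm_le_of_sq hC fun k x => ?_
  rw [Fin.sum_univ_one, ← mul_pow]
  exact pow_le_pow_left₀ (apply_nonneg _ _) (h k x) 2

/-- This turns a uniform bound on a family in `X^△` into the pointwise bounds needed for an operator
to `ℓ_∞`. -/
theorem norm_apply_le_dualNorm {E : Type u} [AddCommGroup E] [Module ℂ E] {S : OpSeqStructure E}
    (f : SB S (hilbert ℂ)) (x : E) :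
    ‖f.1 x‖ ≤ dualNorm S 1 (fun _ => f) * S.norm 1 fun _ => x := by
  have h := le_dualNorm_sq (fun _ : Fin 1 => f) (fun _ : Fin 1 => x)
  rw [Fin.sum_univ_one, hilbert_norm_sq, Fin.sum_univ_one, ← mul_pow] at h
  exact le_of_sq_le_sq h (mul_nonneg (dualNorm_nonneg _) (apply_nonneg _ _))

/-- An operator to a normed space is sequentially bounded for the minimal structure once it is
bounded on the first amplification. -/
theorem seqBoundedBy_min_of_bounded {E : Type u} [AddCommGroup E] [Module ℂ E]
    (S : OpSeqStructure E) {F : Type u} [NormedAddCommGroup F] [NormedSpace ℂ F] (φ : E →ₗ[ℂ] F)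
    {C : ℝ} (hC : 0 ≤ C) (h : ∀ x, ‖φ x‖ ≤ C * S.norm 1 fun _ => x) :
    SeqBoundedBy S (minStructure F) φ C := by
  intro n x
  refine ContinuousLinearMap.opNorm_le_bound _ (mul_nonneg hC (apply_nonneg _ _)) fun ξ => ?_
  -- By linearity only the single vector `∑ i, ξ i • x i` has to be estimated; as the product of the
  -- row matrix `ξ` with `x`, it has norm at most `‖ξ‖ * S.norm n x`.
  have h1 : columnOperator n (fun i => φ (x i)) ξ = φ (∑ i, ξ i • x i) := by
    simp [columnOperator_apply]
  refine (congrArg norm h1).le.trans ((h _).trans ?_)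
  rw [mul_assoc, mul_comm _ ‖ξ‖]
  exact mul_le_mul_of_nonneg_left (norm_sum_smul_le S x ξ) hC

/-- The coordinate functionals on `min(ℓ_∞(Λ))`. -/
noncomputable def coordFunctional {Λ : Type u} (l : Λ) : (minLInfty Λ).dual.carrier :=
  let f : SB (minStructure (lp (fun _ : Λ => ℂ) ∞)) (hilbert ℂ) :=
    ⟨(lp.evalCLM ℂ (fun _ : Λ => ℂ) ∞ l).toLinearMap, ‖lp.evalCLM ℂ (fun _ : Λ => ℂ) ∞ l‖,
      norm_nonneg _, seqBoundedBy_minStructure _⟩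
  f

/-- The operator to `ℓ_∞(Λ)` with prescribed, uniformly bounded, coordinates. -/
def lInftyLift {E : Type u} [AddCommGroup E] [Module ℂ E] {Λ : Type u} (f : Λ → E →ₗ[ℂ] ℂ)
    (h : ∀ x, ∃ C, ∀ l, ‖f l x‖ ≤ C) : E →ₗ[ℂ] lp (fun _ : Λ => ℂ) ∞ where
  toFun x := ⟨fun l => f l x, memℓp_infty (by
    obtain ⟨C, hC⟩ := h x
    exact ⟨C, by rintro _ ⟨l, rfl⟩; exact hC l⟩)⟩
  map_add' x y := by
    ext l
    exact map_add (f l) x y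
  map_smul' c x := by
    ext l
    exact map_smul (f l) c x

/-- `min(ℓ_∞(Λ))` is cofree with base any semilinear normed space with a frame indexed by `Λ`. -/
theorem IsFrame.isCofreeWithBase {M : Nor0.{u}} {Λ : Type u} {e : Λ → M.carrier}
    (he : IsFrame M e) : IsCofreeWithBase pseudoTopDualFunctor.{u} (minLInfty Λ) (op M) := by
  -- The universal arrow sends `e l` to the `l`-th coordinate functional; these have norm at most
  -- `1`, so the family is bounded.
  obtain ⟨j, hj⟩ := he.exists_hom (minLInfty Λ).dual coordFunctional zero_le_one fun l =>
    dualNorm_one_le zero_le_one fun n x =>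
      (seqBoundedBy_minStructure (lp.evalCLM ℂ (fun _ : Λ => ℂ) ∞ l) n x).trans
        (mul_le_mul_of_nonneg_right (ContinuousLinearMap.opNorm_le_bound _ zero_le_one fun y => by
          rw [one_mul]; exact lp.norm_apply_le_norm ENNReal.top_ne_zero y l) (apply_nonneg _ _))
  -- The triangle commutes exactly when the `l`-th coordinate of `ψ` is the functional `φ (e l)` for
  -- every `l`. Both existence and uniqueness of `ψ` follow from this.
  have key : ∀ (X : SQNor.{u}) (φ : M ⟶ firstAmpl X.dual) (ψ : X ⟶ minLInfty Λ),
      pseudoTopDualFunctor.map ψ ≫ Quiver.Hom.op (show M ⟶ firstAmpl (minLInfty Λ).dual from j)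
        = φ.op ↔ ∀ l x, (show lp (fun _ : Λ => ℂ) ∞ from ψ.1 x) l
          = (show SB X.str (hilbert ℂ) from φ.toFun (e l)).1 x := by
    intro X φ ψ
    have h1 : (pseudoTopDualFunctor.map ψ ≫
        Quiver.Hom.op (show M ⟶ firstAmpl (minLInfty Λ).dual from j) = φ.op) ↔
        ((show M ⟶ firstAmpl (minLInfty Λ).dual from j) ≫
          firstAmplFunctor.map (SQNor.dualMap ψ)) = φ :=
      ⟨fun h => Quiver.Hom.op_inj h, fun h => congrArg Quiver.Hom.op h⟩
    have h2 : ∀ l, ((show M ⟶ firstAmpl (minLInfty Λ).dual from j) ≫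
        firstAmplFunctor.map (SQNor.dualMap ψ)).toFun (e l)
          = (SQNor.dualMap ψ).1 (coordFunctional l) := fun l =>
      congrArg (SQNor.dualMap ψ).1 (hj l)
    rw [h1]
    constructor
    · intro h l x
      have h3 := h2 l
      rw [h] at h3
      exact (congrArg (fun g : SB X.str (hilbert ℂ) => g.1 x) h3).symm
    · intro h
      refine he.hom_ext (W := X.dual) fun l => ?_
      refine (h2 l).trans ?_
      apply Subtype.ext
      ext x
      exact h l x
  refine ⟨Quiver.Hom.op (show M ⟶ firstAmpl (minLInfty Λ).dual from j), fun X φ' => ?_⟩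
  obtain ⟨φ, rfl⟩ : ∃ φ : M ⟶ firstAmpl X.dual, φ' = φ.op := ⟨φ'.unop, rfl⟩
  obtain ⟨C, hC, hφ⟩ := φ.bounded
  let f : Λ → SB X.str (hilbert ℂ) := fun l => φ.toFun (e l)
  -- The bound is uniform in `l` because all `e l` have norm `1`, so the bound `C` of `φ` applies to
  -- each `f l`.
  have hf : ∀ l x, ‖(f l).1 x‖ ≤ C * X.str.norm 1 fun _ => x := fun l x => by
    refine (norm_apply_le_dualNorm (f l) x).trans
      (mul_le_mul_of_nonneg_right ?_ (apply_nonneg _ _))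
    have h := hφ (e l)
    rw [he.norm_eq_one, mul_one] at h
    exact h
  let ψ₀ := lInftyLift (fun l => (f l).1) fun x => ⟨_, fun l => hf l x⟩
  have hψ₀ : SeqBoundedBy X.str (minStructure (lp (fun _ : Λ => ℂ) ∞)) ψ₀ C :=
    seqBoundedBy_min_of_bounded _ _ hC fun x =>
      lp.norm_le_of_forall_le (mul_nonneg hC (apply_nonneg _ _)) fun l => hf l x
  refine ⟨⟨ψ₀, C, hC, hψ₀⟩, (key X φ _).2 fun l x => rfl, fun χ hχ => ?_⟩
  apply Subtype.ext
  ext x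
  refine lp.ext (funext fun l => ?_)
  exact (key X φ χ).1 hχ l x

end SQ

/-! ### Characterization of the pseudotopologically cofree spaces -/

theorem mainTheorem8 (X : SQ.SQNor.{u}) :
    SQ.IsPseudoTopCofree X ↔ ∃ Λ : Type u, SQ.SeqTopIsomorphic X (SQ.minLInfty Λ) := by
  constructor
  · rintro ⟨M, hM⟩
    obtain ⟨Λ, e, he⟩ := SQ.exists_isFrame M.unop
    exact ⟨Λ, hM.nonempty_iso he.isCofreeWithBase⟩
  · rintro ⟨Λ, ⟨i⟩⟩
    exact ⟨_, (SQ.isFrame_rays Λ).isCofreeWithBase.of_iso i⟩
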